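/- Let $G=(V,E)$ be a finite graph and $S\subseteq V$. Put $\mathcal P^0(S)=N[S]$ (the closed neighbourhood of $S$) and, for $t\ge 0$, let $\mathcal P^{t+1}(S)$ be $\mathcal P^{t}(S)$ together with all vertices $x$ for which there is $v\in\mathcal P^{t}(S)$ with $N_G(v)\setminus \mathcal P^{t}(S)=\{x\}$. The set $S$ is a power dominating set of $G$ if $\mathcal P^{t}(S)=V$ for some $t$ (equivalently, if the eventual value of the increasing sequence $\mathcal P^{t}(S)$ is $V$). Let $T_{m,h}$ be the complete $m$-ary tree of height $h$ (every vertex at distance less than $h$ from the root $r$ has exactly $m$ children, and the vertices at distance $h$ are the leaves), with labeled vertices, and let $T^+_{m,h}$ be obtained from $T_{m,h}$ by adding one new vertex $r'$ (the stem) and the edge $\{r,r'\}$. A set $S\subseteq V(T^+_{m,h})\setminus\{r'\}$ is of Type I if it is a power dominating set of $T^+_{m,h}$, and of Type II if it is not, but $S\cup\{r'\}$ is. Let $E_{m,h}^k$ and $H_{m,h}^k$ be the numbers of Type I and Type II sets of size $k$, respectively. For $0\le \ell\le m$ and an integer $k$ put $$\left\langle \mathcal H^{\ell}\oplus\mathcal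 E^{m-\ell}\right\rangle_{m,h}^{k}=\sum_{\substack{i_1\le\cdots\le i_\ell\\ i_{\ell+1}\le\cdots\le i_m\\ i_1+\cdots+i_m=k}}\binom{m}{\ell}\binom{\ell}{s_0,\ldots,s_k}\binom{m-\ell}{t_0,\ldots,t_k}\Big(\prod_{1\le j\le \ell}H_{m,h}^{i_j}\Big)\Big(\prod_{\ell<j\le m}E_{m,h}^{i_j}\Big),$$ where the $i_j$ are non-negative integers, $s_\alpha=|\{j\le \ell: i_j=\alpha\}|$ and $t_\beta=|\{j>\ell: i_j=\beta\}|$; for $k<0$ the sum is empty and equals $0$. Theorem. Let $m\ge 2$, $h\ge 2$ and $k\ge 0$ be integers. The number $N(m,h,k)$ of power dominating sets of size $k$ of $T_{m,h}$ is $$N(m,h,k)=\begin{cases}\displaystyle\sum_{\ell=0}^{m-1}\left\langle \mathcal H^{\ell}\oplus\mathcal E^{m-\ell}\right\rangle_{m,h-1}^{k}+\sum_{\ell=0}^{m}\left\langle \mathcal H^{\ell}\oplus\mathcal E^{m-\ell}\right\rangle_{m,h-1}^{k-1}, & h\text{ even},\\[2ex]\displaystyle\sum_{\ell=0}^{1}\left\langle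 \mathcal H^{\ell}\oplus\mathcal E^{m-\ell}\right\rangle_{m,h-1}^{k}+\sum_{\ell=0}^{m}\left\langle \mathcal H^{\ell}\oplus\mathcal E^{m-\ell}\right\rangle_{m,h-1}^{k-1}, & h\text{ odd}.\end{cases}$$ -/

import Mathlib

open Finset

namespace PowerDomination

/-- The sets `P^t(S)`: `P^0(S)` is the closed neighbourhood `N[S]`, and at each further step a
vertex `x` is added if it is the only neighbour outside the current set of some vertex of the
current set. -/
def observedAt {V : Type*} (G : SimpleGraph V) (S : Set V) : ℕ → Set V
  | 0 => S ∪ {x | ∃ v ∈ S, G.Adj v x}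
  | t + 1 => observedAt G S t ∪
      {x | ∃ v ∈ observedAt G S t, G.neighborSet v \ observedAt G S t = {x}}

/-- The set `P^∞(S)` of all vertices that are eventually observed. The sets `P^t(S)` increase
with `t`, so on a finite graph this union is their eventual value. -/
def observed {V : Type*} (G : SimpleGraph V) (S : Set V) : Set V :=
  ⋃ t, observedAt G S t

/-- `S` is a power dominating set of `G`. -/
def IsPowerDominating {V : Type*} (G : SimpleGraph V) (S : Set V) : Prop :=
  observed G S = Set.univ

/-- Vertices of the complete `m`-ary tree of height `h`: words of length at most `h` over an
alphabet with `m` letters. The word lists the choices made on the path from the root. -/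
abbrev TreeVertex (m h : ℕ) : Type := {w : List (Fin m) // w.length ≤ h}

/-- The root, i.e. the empty word. -/
def root (m h : ℕ) : TreeVertex m h := ⟨[], Nat.zero_le h⟩

/-- `v` is a child of `u`: the word `v` is `u` followed by one more letter. -/
def IsChild {m h : ℕ} (u v : TreeVertex m h) : Prop := ∃ a : Fin m, v.1 = u.1 ++ [a]

/-- The complete `m`-ary tree `T_{m,h}` of height `h`. -/
def completeTree (m h : ℕ) : SimpleGraph (TreeVertex m h) :=
  SimpleGraph.fromRel IsChild

/-- The extended tree `T⁺_{m,h}`: a new vertex `none` (the stem `r'`) is added to `T_{m,h}`,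
together with an edge joining it to the root. -/
def extendedTree (m h : ℕ) : SimpleGraph (Option (TreeVertex m h)) :=
  (completeTree m h).map some ⊔
    SimpleGraph.fromEdgeSet {s(some (root m h), none)}

/-- `S`, not containing the stem, is Type I: it is a power dominating set of `T⁺_{m,h}`. -/
def IsTypeI (m h : ℕ) (S : Finset (Option (TreeVertex m h))) : Prop :=
  none ∉ S ∧ IsPowerDominating (extendedTree m h) (S : Set (Option (TreeVertex m h)))

/-- `S`, not containing the stem, is Type II: it is not a power dominating set of `T⁺_{m,h}`, but
becomes one once the stem is added to it. -/
def IsTypeII (m h : ℕ) (S : Finset (Option (TreeVertex m h))) : Prop :=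
  none ∉ S ∧ ¬ IsPowerDominating (extendedTree m h) (S : Set (Option (TreeVertex m h))) ∧
    IsPowerDominating (extendedTree m h) ((S : Set (Option (TreeVertex m h))) ∪ {none})

/-- `E_{m,h}^k`, the number of Type I sets of size `k` for `T⁺_{m,h}`. -/
noncomputable def numTypeI (m h k : ℕ) : ℕ :=
  Set.ncard {S : Finset (Option (TreeVertex m h)) | S.card = k ∧ IsTypeI m h S}

/-- `H_{m,h}^k`, the number of Type II sets of size `k` for `T⁺_{m,h}`. -/
noncomputable def numTypeII (m h k : ℕ) : ℕ :=
  Set.ncard {S : Finset (Option (TreeVertex m h)) | S.card = k ∧ IsTypeII m h S}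

/-- `N(m,h,k)`, the number of power dominating sets of size `k` of `T_{m,h}`. -/
noncomputable def numPowerDominating (m h k : ℕ) : ℕ :=
  Set.ncard {S : Finset (TreeVertex m h) |
    S.card = k ∧ IsPowerDominating (completeTree m h) (S : Set (TreeVertex m h))}

open Classical in
/-- The bracket sum `⟨H^ℓ ⊕ E^{m-ℓ}⟩_{m,h}^k`. The sum is over the sequences `i` of `m` integers
in `{0, …, k}` with sum `k` whose first `ℓ` terms are non-decreasing and whose last `m - ℓ` terms
are non-decreasing (positions are counted from `0`). The index `k` is an integer, and the sum is
empty for `k < 0`. -/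
noncomputable def bracket (m h l : ℕ) (k : ℤ) : ℕ :=
  ∑ i : Fin m → Fin (k.toNat + 1) with
      (∀ a b : Fin m, a ≤ b → b.1 < l → i a ≤ i b) ∧
      (∀ a b : Fin m, a ≤ b → l ≤ a.1 → i a ≤ i b) ∧
      ∑ j, ((i j : ℕ) : ℤ) = k,
    m.choose l *
      Nat.multinomial univ (fun α => #{j : Fin m | j.1 < l ∧ i j = α}) *
      Nat.multinomial univ (fun β => #{j : Fin m | l ≤ j.1 ∧ i j = β}) *
      (∏ j : Fin m with j.1 < l, numTypeII m h (i j)) *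
      (∏ j : Fin m with l ≤ j.1, numTypeI m h (i j))

end PowerDomination

/-! In the tree of height `h + 1`, each of the `m` branches at the root, taken together with the
root, is a copy of the extended tree of height `h` with the root as its stem. A power dominating set
restricts to a Type I or Type II set on every branch (`PD1.branch`). Given this, only two data
matter: whether the root is chosen, and the number ℓ of Type II branches. If the root is chosen,
every ℓ works (`pd0_of_root_mem`), and `k - 1` elements remain for the branches.

If the root is not chosen, the decisive fact is `obs0_root_iff_odd`: without its stem, a Type II set
observes the root of its tree exactly when the height is odd. For branches of odd height all branch
roots are observed from inside, so one Type I branch, which also observes the root, suffices: ℓ < m.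
For branches of even height a Type II branch needs its root forced from above, and the root can
force only one child: ℓ ≤ 1.

For the count, let p and q be the generating functions by size of Type II and Type I sets. Families
with ℓ Type II branches contribute `m.choose ℓ * p ^ ℓ * q ^ (m - ℓ)` (`sum_families`), and the
bracket is the coefficient of this product, by the multinomial theorem over non-decreasing sequences
(`bracket_eq_coeff`). -/

namespace PowerDomination

/-- Inductive description of the vertices that are eventually observed. -/
inductive Obs {V : Type*} (G : SimpleGraph V) (S : Set V) : V → Prop
  | mem {v : V} : v ∈ S → Obs G S v
  | dom {v x : V} : v ∈ S → G.Adj v x → Obs G S x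
  | force {v x : V} : Obs G S v → G.Adj v x → (∀ y, G.Adj v y → y ≠ x → Obs G S y) → Obs G S x

/-! ### Observation as an inductive closure -/

section General

variable {V : Type*} {G : SimpleGraph V} {S : Set V}

theorem observedAt_mono : Monotone (observedAt G S) :=
  monotone_nat_of_le_succ fun _ _ hx => Or.inl hx

theorem obs_of_mem_observedAt {t : ℕ} {x : V} (hx : x ∈ observedAt G S t) : Obs G S x := by
  induction t generalizing x with
  | zero =>
    rcases hx with hx | ⟨v, hv, h⟩
    · exact .mem hx
    · exact .dom hv h
  | succ t ih =>
    rcases hx with hx | ⟨v, hv, h⟩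
    · exact ih hx
    · have hx : x ∈ G.neighborSet v \ observedAt G S t := by rw [h]; rfl
      refine .force (ih hv) hx.1 fun y hy hne => ih ?_
      by_contra hn
      have : y ∈ G.neighborSet v \ observedAt G S t := ⟨hy, hn⟩
      rw [h] at this
      exact hne this

/-- By finiteness some time T sees every vertex that is ever observed, so a force whose premises
hold eventually is a legal step at time T. -/
theorem mem_observed_iff [Finite V] {x : V} : x ∈ observed G S ↔ Obs G S x := by
  constructor
  · intro h
    obtain ⟨t, ht⟩ := Set.mem_iUnion.1 h
    exact obs_of_mem_observedAt ht
  · obtain ⟨T, hT⟩ : ∃ T, ∀ y ∈ observed G S, y ∈ observedAt G S T := by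
      have key : ∀ y, ∃ t, y ∈ observed G S → y ∈ observedAt G S t := by
        intro y
        by_cases h : y ∈ observed G S
        · obtain ⟨t, ht⟩ := Set.mem_iUnion.1 h
          exact ⟨t, fun _ => ht⟩
        · exact ⟨0, fun h' => absurd h' h⟩
      choose f hf using key
      obtain ⟨T, hT⟩ := (Set.finite_range f).bddAbove
      exact ⟨T, fun y hy => observedAt_mono (hT ⟨y, rfl⟩) (hf y hy)⟩
    intro h
    induction h with
    | mem hv => exact Set.mem_iUnion.2 ⟨0, Or.inl hv⟩
    | dom hv ha => exact Set.mem_iUnion.2 ⟨0, Or.inr ⟨_, hv, ha⟩⟩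
    | @force v x _ ha _ ihv ih =>
      by_cases hx : x ∈ observedAt G S T
      · exact Set.mem_iUnion.2 ⟨T, hx⟩
      · refine Set.mem_iUnion.2 ⟨T + 1, Or.inr ⟨v, hT _ ihv, ?_⟩⟩
        ext y
        constructor
        · rintro ⟨hy, hy'⟩
          by_contra hne
          exact hy' (hT _ (ih y hy hne))
        · rintro rfl
          exact ⟨ha, hx⟩

theorem isPowerDominating_iff [Finite V] : IsPowerDominating G S ↔ ∀ x, Obs G S x := by
  simp only [IsPowerDominating, Set.eq_univ_iff_forall, mem_observed_iff]

theorem Obs.mono {S' : Set V} (h : S ⊆ S') {x : V} (hx : Obs G S x) : Obs G S' x := by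
  induction hx with
  | mem hv => exact .mem (h hv)
  | dom hv ha => exact .dom (h hv) ha
  | force _ ha _ ihv ih => exact .force ihv ha ih

end General

/-! ### Branches as extended trees -/

section Tree

variable {m h : ℕ}

instance : Finite (TreeVertex m h) := (List.finite_length_le (Fin m) h).to_subtype

noncomputable instance : Fintype (TreeVertex m h) := Fintype.ofFinite _

/-- The vertex of the `j`-th branch at the root that corresponds to `w`. -/
def graft (j : Fin m) (w : TreeVertex m h) : TreeVertex m (h + 1) :=
  ⟨j :: w.1, by simpa using w.2⟩

/-- The `j`-th branch as an extended tree whose stem is the root. -/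
def graftStem (j : Fin m) : Option (TreeVertex m h) → Option (TreeVertex m (h + 1))
  | none => some (root m (h + 1))
  | some w => some (graft j w)

@[simp] theorem graft_inj {i j : Fin m} {v w : TreeVertex m h} :
    graft i v = graft j w ↔ i = j ∧ v = w := by
  simp [graft, Subtype.ext_iff]

@[simp] theorem graft_ne_root {j : Fin m} {w : TreeVertex m h} : graft j w ≠ root m (h + 1) := by
  simp [graft, root]

theorem eq_root_or_graft (v : TreeVertex m (h + 1)) :
    v = root m (h + 1) ∨ ∃ j w, v = graft j w := by
  obtain ⟨_ | ⟨j, w⟩, hv⟩ := v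
  · exact Or.inl rfl
  · exact Or.inr ⟨j, ⟨w, by simpa using hv⟩, rfl⟩

theorem isChild_graft_left {j : Fin m} {w : TreeVertex m h} {v : TreeVertex m (h + 1)} :
    IsChild (graft j w) v ↔ ∃ v', v = graft j v' ∧ IsChild w v' := by
  constructor
  · rintro ⟨a, ha⟩
    have hl : (w.1 ++ [a]).length ≤ h := by
      have := v.2
      rw [ha] at this
      simpa [graft] using this
    exact ⟨⟨w.1 ++ [a], hl⟩, Subtype.ext ha, a, rfl⟩
  · rintro ⟨v', rfl, a, ha⟩
    exact ⟨a, by simp [graft, ha]⟩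

theorem isChild_graft_right {j : Fin m} {w : TreeVertex m h} {u : TreeVertex m (h + 1)} :
    IsChild u (graft j w) ↔
      (u = root m (h + 1) ∧ w = root m h) ∨ ∃ u', u = graft j u' ∧ IsChild u' w := by
  rcases eq_root_or_graft u with rfl | ⟨i, u, rfl⟩
  · simp [IsChild, graft, root, Subtype.ext_iff]
  · constructor
    · rintro ⟨a, ha⟩
      obtain ⟨rfl, ha'⟩ := List.cons.inj ha
      exact Or.inr ⟨u, rfl, a, ha'⟩
    · rintro (⟨hu, -⟩ | ⟨u', hu, a, ha⟩)
      · simp at hu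
      · obtain ⟨rfl, rfl⟩ := graft_inj.1 hu
        exact ⟨a, by simp [graft, ha]⟩

theorem isChild_ne {u v : TreeVertex m h} (huv : IsChild u v) : u ≠ v := by
  rintro rfl
  obtain ⟨a, ha⟩ := huv
  simpa using congrArg List.length ha

theorem completeTree_adj {u v : TreeVertex m h} :
    (completeTree m h).Adj u v ↔ IsChild u v ∨ IsChild v u := by
  simp only [completeTree, SimpleGraph.fromRel_adj]
  exact ⟨fun h => h.2, fun h => ⟨h.elim isChild_ne fun h' => (isChild_ne h').symm, h⟩⟩

@[simp] theorem extendedTree_adj_none {x : Option (TreeVertex m h)} :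
    (extendedTree m h).Adj none x ↔ x = some (root m h) := by
  cases x <;> simp [extendedTree, SimpleGraph.map_adj']

@[simp] theorem extendedTree_adj_some_none {u : TreeVertex m h} :
    (extendedTree m h).Adj (some u) none ↔ u = root m h := by
  simp [extendedTree, SimpleGraph.map_adj']

@[simp] theorem extendedTree_adj_some_some {u v : TreeVertex m h} :
    (extendedTree m h).Adj (some u) (some v) ↔ (completeTree m h).Adj u v := by
  simpa [extendedTree, SimpleGraph.map_adj'] using fun h => h.ne

/-- A branch meets the rest of the tree only at the root, so neighbourhoods of branch vertices
transfer exactly, the root playing the stem. This is what makes observation inside a branch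
comparable with observation in the whole tree. -/
theorem extendedTree_adj_graft {j : Fin m} {w : TreeVertex m h}
    {x : Option (TreeVertex m (h + 1))} :
    (extendedTree m (h + 1)).Adj (some (graft j w)) x ↔
      ∃ y, x = graftStem j y ∧ (extendedTree m h).Adj (some w) y := by
  rcases x with _ | v
  · simp only [extendedTree_adj_some_none, graft_ne_root, false_iff]
    rintro ⟨_ | y, hy, -⟩ <;> simp [graftStem] at hy
  · simp only [extendedTree_adj_some_some, completeTree_adj, isChild_graft_left,
      isChild_graft_right, Option.exists, graftStem, Option.some.injEq,
      extendedTree_adj_some_none]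
    constructor
    · rintro (⟨v', rfl, hv⟩ | ⟨rfl, hw⟩ | ⟨v', rfl, hv⟩)
      · exact Or.inr ⟨v', rfl, Or.inl hv⟩
      · exact Or.inl ⟨rfl, hw⟩
      · exact Or.inr ⟨v', rfl, Or.inr hv⟩
    · rintro (⟨rfl, hw⟩ | ⟨v', rfl, hv | hv⟩)
      · exact Or.inr (Or.inl ⟨rfl, hw⟩)
      · exact Or.inl ⟨v', rfl, hv⟩
      · exact Or.inr (Or.inr ⟨v', rfl, hv⟩)

theorem extendedTree_adj_root {x : Option (TreeVertex m (h + 1))} :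
    (extendedTree m (h + 1)).Adj (some (root m (h + 1))) x ↔
      x = none ∨ ∃ j, x = some (graft j (root m h)) := by
  rcases x with _ | v
  · simp
  · rcases eq_root_or_graft v with rfl | ⟨j, w, rfl⟩
    · simp [graft_ne_root.symm]
    · rw [SimpleGraph.adj_comm, extendedTree_adj_graft]
      simp [Option.exists, graftStem, graft_ne_root.symm]

/-- The vertices of `T⁺` observed by a set of vertices of `T`. -/
abbrev Obs0 (S : Set (TreeVertex m h)) : Option (TreeVertex m h) → Prop :=
  Obs (extendedTree m h) (some '' S)

/-- The vertices of `T⁺` observed by a set of vertices of `T` together with the stem. -/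
abbrev Obs1 (S : Set (TreeVertex m h)) : Option (TreeVertex m h) → Prop :=
  Obs (extendedTree m h) (some '' S ∪ {none})

/-- `S` is a power dominating set of `T⁺`. -/
def PD0 (S : Set (TreeVertex m h)) : Prop := ∀ x, Obs0 S x

/-- `S` together with the stem is a power dominating set of `T⁺`. -/
def PD1 (S : Set (TreeVertex m h)) : Prop := ∀ x, Obs1 S x

theorem Obs0.obs1 {S : Set (TreeVertex m h)} {x} (hx : Obs0 S x) : Obs1 S x :=
  hx.mono Set.subset_union_left

theorem PD0.pd1 {S : Set (TreeVertex m h)} (hS : PD0 S) : PD1 S := fun x => (hS x).obs1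

theorem obs0_root_of_none {S : Set (TreeVertex m h)} (hS : Obs0 S none) :
    Obs0 S (some (root m h)) :=
  .force hS (by simp) (by simp +contextual)

theorem obs1_root (S : Set (TreeVertex m h)) : Obs1 S (some (root m h)) :=
  .dom (v := none) (by simp) (by simp)

/-- If the stem is observed without being chosen, then choosing it changes nothing. -/
theorem obs0_of_obs1 {S : Set (TreeVertex m h)} (hS : Obs0 S none) {x} (hx : Obs1 S x) :
    Obs0 S x := by
  induction hx with
  | mem hv =>
    rcases hv with hv | rfl
    · exact .mem hv
    · exact hS
  | dom hv ha =>
    rcases hv with hv | rfl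
    · exact .dom hv ha
    · rw [extendedTree_adj_none.1 ha]
      exact obs0_root_of_none hS
  | force _ ha _ ihv ih => exact .force ihv ha ih

theorem not_obs0_none {S : Set (TreeVertex m h)} (h1 : PD1 S) (h0 : ¬ PD0 S) :
    ¬ Obs0 S none := fun hn => h0 fun x => obs0_of_obs1 hn (h1 x)

/-- The part of `S` in the `j`-th branch at the root. -/
def branch (S : Set (TreeVertex m (h + 1))) (j : Fin m) : Set (TreeVertex m h) := graft j ⁻¹' S

/-! ### Passing observation between a branch and the whole tree -/

section Branches

variable {S : Set (TreeVertex m (h + 1))} {B : Set (Option (TreeVertex m (h + 1)))}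

/-- The second conjunct handles forces by the stem: in the whole tree the stem is the root, with
more neighbours, so the force need not be legal there. It is never needed, as an unchosen stem is
observed only after the branch root. -/
theorem obs_of_branch_obs0 (hB : some '' S ⊆ B) {j : Fin m} {x} (hx : Obs0 (branch S j) x) :
    Obs (extendedTree m (h + 1)) B (graftStem j x) ∧
      (x = none → Obs (extendedTree m (h + 1)) B (some (graft j (root m h)))) := by
  induction hx with
  | mem hv =>
    obtain ⟨w, hw, rfl⟩ := hv
    exact ⟨.mem (hB ⟨_, hw, rfl⟩), by simp⟩
  | @dom v x hv ha =>
    obtain ⟨w, hw, rfl⟩ := hv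
    refine ⟨.dom (hB ⟨_, hw, rfl⟩) (extendedTree_adj_graft.2 ⟨x, rfl, ha⟩), ?_⟩
    rintro rfl
    rw [extendedTree_adj_some_none] at ha
    subst ha
    exact .mem (hB ⟨_, hw, rfl⟩)
  | @force v x _ ha _ ihv ih =>
    rcases v with _ | w
    · rw [extendedTree_adj_none] at ha
      subst ha
      exact ⟨ihv.2 rfl, by simp⟩
    · refine ⟨.force ihv.1 (extendedTree_adj_graft.2 ⟨x, rfl, ha⟩) fun y hy hne => ?_, ?_⟩
      · obtain ⟨y, rfl, hy'⟩ := extendedTree_adj_graft.1 hy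
        exact (ih y hy' (by rintro rfl; exact hne rfl)).1
      · rintro rfl
        rw [extendedTree_adj_some_none] at ha
        subst ha
        exact ihv.1

/-- A chosen stem contributes only itself and the branch root; `hr` and `hj` supply these two when
the root itself is not chosen. -/
theorem obs_of_branch_obs1 (hB : some '' S ⊆ B) {j : Fin m}
    (hr : Obs (extendedTree m (h + 1)) B (some (root m (h + 1))))
    (hj : Obs (extendedTree m (h + 1)) B (some (graft j (root m h))))
    {x} (hx : Obs1 (branch S j) x) : Obs (extendedTree m (h + 1)) B (graftStem j x) := by
  induction hx with
  | mem hv =>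
    rcases hv with ⟨w, hw, rfl⟩ | rfl
    · exact .mem (hB ⟨_, hw, rfl⟩)
    · exact hr
  | @dom v x hv ha =>
    rcases hv with ⟨w, hw, rfl⟩ | rfl
    · exact .dom (hB ⟨_, hw, rfl⟩) (extendedTree_adj_graft.2 ⟨x, rfl, ha⟩)
    · rw [extendedTree_adj_none.1 ha]
      exact hj
  | @force v x _ ha _ ihv ih =>
    rcases v with _ | w
    · rw [extendedTree_adj_none.1 ha]
      exact hj
    · refine .force ihv (extendedTree_adj_graft.2 ⟨x, rfl, ha⟩) fun y hy hne => ?_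
      obtain ⟨y, rfl, hy'⟩ := extendedTree_adj_graft.1 hy
      exact ih y hy' (by rintro rfl; exact hne rfl)

/-- Once the root, its children and the stem are observed, branches that are dominated with the
help of the root are observed. -/
theorem obs_all (hB : some '' S ⊆ B) (hP : ∀ j, PD1 (branch S j))
    (hr : Obs (extendedTree m (h + 1)) B (some (root m (h + 1))))
    (hj : ∀ j, Obs (extendedTree m (h + 1)) B (some (graft j (root m h))))
    (x) : Obs (extendedTree m (h + 1)) B x := by
  rcases x with _ | v
  · refine .force hr (by simp) fun y hy hne => ?_
    rcases extendedTree_adj_root.1 hy with rfl | ⟨j, rfl⟩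
    · exact absurd rfl hne
    · exact hj j
  · rcases eq_root_or_graft v with rfl | ⟨j, w, rfl⟩
    · exact hr
    · exact obs_of_branch_obs1 hB hr (hj j) (hP j (some w))

/-- Outside help enters a branch only through the root, and can give no more than a chosen stem
does, namely the stem and the branch root. -/
theorem PD1.branch (hS : PD1 S) (j : Fin m) : PD1 (branch S j) := by
  have key : ∀ x, Obs1 S x → ∀ w, x = some (graft j w) →
      Obs1 (PowerDomination.branch S j) (some w) := by
    intro x hx
    induction hx with
    | mem hv =>
      rintro w rfl
      rcases hv with ⟨u, hu, hw⟩ | hv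
      · cases hw
        exact .mem (Or.inl ⟨w, hu, rfl⟩)
      · cases hv
    | @dom v x hv ha =>
      rintro w rfl
      obtain ⟨y, rfl, hy⟩ := extendedTree_adj_graft.1 ha.symm
      rcases y with _ | u
      · rw [extendedTree_adj_some_none] at hy
        subst hy
        exact obs1_root _
      · rcases hv with ⟨u', hu, hw⟩ | hv
        · cases hw
          exact .dom (Or.inl ⟨u, hu, rfl⟩) hy.symm
        · cases hv
    | @force v x _ ha _ ihv ih =>
      rintro w rfl
      obtain ⟨y, rfl, hy⟩ := extendedTree_adj_graft.1 ha.symm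
      rcases y with _ | u
      · rw [extendedTree_adj_some_none] at hy
        subst hy
        exact obs1_root _
      · refine .force (ihv u rfl) hy.symm fun y hy' hne => ?_
        rcases y with _ | y
        · exact .mem (by simp)
        · exact ih _ (extendedTree_adj_graft.2 ⟨some y, rfl, hy'⟩)
            (by simpa [graftStem] using hne) y rfl
  have hsome : ∀ w, Obs1 (PowerDomination.branch S j) (some w) := fun w => key _ (hS _) w rfl
  rintro (_ | w)
  · exact .mem (by simp)
  · exact hsome w

theorem pd0_of_root_mem (hr : root m (h + 1) ∈ S) (hP : ∀ j, PD1 (branch S j)) : PD0 S :=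
  obs_all subset_rfl hP (.mem ⟨_, hr, rfl⟩)
    fun j => .dom ⟨_, hr, rfl⟩ (extendedTree_adj_root.2 (Or.inr ⟨j, rfl⟩))

theorem obs0_root_of_branch {j : Fin m} (hj : PD0 (branch S j)) :
    Obs0 S (some (root m (h + 1))) :=
  (obs_of_branch_obs0 subset_rfl (hj none)).1

/-- If no branch observes the root, then observation does not spread beyond the branches. -/
theorem not_obs0_root (hr : root m (h + 1) ∉ S) (hn : ∀ j, ¬ Obs0 (branch S j) none) :
    ¬ Obs0 S (some (root m (h + 1))) := by
  have key : ∀ x, Obs0 S x → ∃ j w, x = some (graft j w) ∧ Obs0 (branch S j) (some w) := by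
    intro x hx
    induction hx with
    | mem hv =>
      obtain ⟨v, hv, rfl⟩ := hv
      rcases eq_root_or_graft v with rfl | ⟨j, w, rfl⟩
      · exact absurd hv hr
      · exact ⟨j, w, rfl, .mem ⟨w, hv, rfl⟩⟩
    | @dom v x hv ha =>
      obtain ⟨v, hv, rfl⟩ := hv
      rcases eq_root_or_graft v with rfl | ⟨j, w, rfl⟩
      · exact absurd hv hr
      · obtain ⟨y, rfl, hy⟩ := extendedTree_adj_graft.1 ha
        have ho : Obs0 (branch S j) y := .dom ⟨w, hv, rfl⟩ hy
        rcases y with _ | y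
        · exact absurd ho (hn j)
        · exact ⟨j, y, rfl, ho⟩
    | @force v x _ ha _ ihv ih =>
      obtain ⟨j, w, rfl, hw⟩ := ihv
      obtain ⟨y, rfl, hy⟩ := extendedTree_adj_graft.1 ha
      have ho : Obs0 (branch S j) y := by
        refine .force hw hy fun z hz hne => ?_
        have hne' : graftStem j z ≠ graftStem j y := by
          rcases z with _ | z <;> rcases y with _ | y <;>
            simp_all [graftStem, graft_ne_root.symm]
        obtain ⟨i, u, hu, hu'⟩ := ih _ (extendedTree_adj_graft.2 ⟨z, rfl, hz⟩) hne'
        rcases z with _ | z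
        · simp [graftStem, graft_ne_root.symm] at hu
        · simp only [graftStem, Option.some.injEq, graft_inj] at hu
          obtain ⟨rfl, rfl⟩ := hu
          exact hu'
      rcases y with _ | y
      · exact absurd ho (hn j)
      · exact ⟨j, y, rfl, ho⟩
  intro h0
  obtain ⟨j, w, hw, -⟩ := key _ h0
  simp [graft_ne_root.symm] at hw

/-- The roots of two distinct branches which do not observe them stay unobserved. -/
theorem not_pd1_of_two (hr : root m (h + 1) ∉ S) {a b : Fin m} (hab : a ≠ b)
    (ha : ¬ Obs0 (branch S a) (some (root m h))) (hb : ¬ Obs0 (branch S b) (some (root m h))) :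
    ¬ PD1 S := by
  -- Invariant: a branch that does not observe its own root gets no help from outside, even when the
  -- stem is chosen.
  have key : ∀ x, Obs1 S x → ∀ j, ¬ Obs0 (branch S j) (some (root m h)) →
      ∀ w, x = some (graft j w) → Obs0 (branch S j) (some w) := by
    intro x hx
    induction hx with
    | mem hv =>
      rintro j hj w rfl
      rcases hv with ⟨u, hu, hw⟩ | hv
      · cases hw
        exact .mem ⟨w, hu, rfl⟩
      · cases hv
    | @dom v x hv hadj =>
      rintro j hj w rfl
      obtain ⟨y, rfl, hy⟩ := extendedTree_adj_graft.1 hadj.symm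
      rcases hv with ⟨u, hu, hw⟩ | hv
      · rcases y with _ | y
        · cases hw
          exact absurd hu hr
        · cases hw
          exact .dom ⟨y, hu, rfl⟩ hy.symm
      · rcases y with _ | y <;> cases hv
    | @force v x _ hadj _ ihv ih =>
      -- The root can never force: its only unobserved neighbour would have to be both the root of
      -- branch `a` and that of branch `b`.
      have hroot : v ≠ some (root m (h + 1)) := by
        rintro rfl
        have hc : ∀ j, ¬ Obs0 (branch S j) (some (root m h)) →
            x = some (graft j (root m h)) := by
          intro j hj
          by_contra hne
          exact hj (ih _ (extendedTree_adj_root.2 (Or.inr ⟨j, rfl⟩)) (Ne.symm hne) j hj _ rfl)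
        have := (hc a ha).symm.trans (hc b hb)
        simp only [Option.some.injEq, graft_inj] at this
        exact hab this.1
      rintro j hj w rfl
      obtain ⟨y, rfl, hy⟩ := extendedTree_adj_graft.1 hadj.symm
      rcases y with _ | u
      · exact absurd rfl hroot
      · refine .force (ihv j hj u rfl) hy.symm fun y hy' hne => ?_
        rcases y with _ | y
        · rw [extendedTree_adj_some_none] at hy'
          subst hy'
          exact absurd (ihv j hj _ rfl) hj
        · exact ih _ (extendedTree_adj_graft.2 ⟨some y, rfl, hy'⟩)
            (by simpa [graftStem] using hne) j hj y rfl
  exact fun h1 => ha (key _ (h1 _) a ha _ rfl)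

end Branches

/-! ### Parity of the height and the characterisation of power dominating sets -/

section Parity

variable {S : Set (TreeVertex m (h + 1))}

/-- If one branch observes the root and the others observe their own roots, then everything is
observed. -/
theorem pd0_of_children (hP : ∀ j, PD1 (branch S j))
    (hc : ∀ j, Obs0 (branch S j) (some (root m h))) {i : Fin m} (hi : PD0 (branch S i)) :
    PD0 S :=
  obs_all subset_rfl hP (obs0_root_of_branch hi)
    fun j => (obs_of_branch_obs0 subset_rfl (hc j)).1

/-- If at most one branch needs help, the stem and the root provide it. -/
theorem pd1_of_subsingleton (hP : ∀ j, PD1 (branch S j))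
    (hc : ∀ a b, ¬ PD0 (branch S a) → ¬ PD0 (branch S b) → a = b) : PD1 S := by
  refine obs_all Set.subset_union_left hP (obs1_root S) fun j => ?_
  by_cases hj : PD0 (branch S j)
  · exact (obs_of_branch_obs0 Set.subset_union_left (hj (some (root m h)))).1
  · refine .force (obs1_root S) (extendedTree_adj_root.2 (Or.inr ⟨j, rfl⟩)) fun y hy hne => ?_
    rcases extendedTree_adj_root.1 hy with rfl | ⟨i, rfl⟩
    · exact .mem (by simp)
    · have hi : PD0 (branch S i) := by
        by_contra hi
        exact hne (by rw [hc i j hi hj])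
      exact (obs_of_branch_obs0 Set.subset_union_left (hi (some (root m h)))).1

/-- By induction on the height. If the branches have odd height, their roots are all observed from
inside; a Type I branch would then make the set Type I, so all branches are Type II and the root
stays unobserved. If they have even height and the root were unobserved, all branches would be Type
II with unobserved roots, and two of these block domination even with the stem. -/
theorem obs0_root_iff_odd (hm : 2 ≤ m) :
    ∀ {h : ℕ} {S : Set (TreeVertex m h)}, PD1 S → ¬ PD0 S →
      (Obs0 S (some (root m h)) ↔ Odd h) := by
  intro h
  induction h with
  | zero =>
    intro S h1 h0
    have huniq : ∀ v : TreeVertex m 0, v = root m 0 := fun v =>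
      Subtype.ext (List.length_eq_zero_iff.1 (Nat.le_zero.1 v.2))
    have hS : S = ∅ := by
      refine Set.eq_empty_of_forall_notMem fun v hv => h0 ?_
      obtain rfl := huniq v
      rintro (_ | v)
      · exact .dom ⟨_, hv, rfl⟩ (by simp)
      · rw [huniq v]
        exact .mem ⟨_, hv, rfl⟩
    subst hS
    have : ∀ x, ¬ Obs0 (∅ : Set (TreeVertex m 0)) x := by
      intro x hx
      induction hx with
      | mem hv => simp at hv
      | dom hv => simp at hv
      | force _ _ _ ih => exact ih
    simp [this]
  | succ h ih =>
    intro S h1 h0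
    have hP := h1.branch
    have hr : root m (h + 1) ∉ S := fun hr => h0 (pd0_of_root_mem hr hP)
    rw [Nat.odd_add_one]
    by_cases ho : Odd h
    · have hc : ∀ j, Obs0 (branch S j) (some (root m h)) := fun j => by
        by_cases hj : PD0 (branch S j)
        · exact hj _
        · exact (ih (hP j) hj).2 ho
      have hn : ∀ j, ¬ PD0 (branch S j) := fun j hj => h0 (pd0_of_children hP hc hj)
      simp only [ho, not_true_eq_false, iff_false]
      exact not_obs0_root hr fun j => not_obs0_none (hP j) (hn j)
    · simp only [ho, not_false_eq_true, iff_true]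
      by_contra hroot
      have hn : ∀ j, ¬ PD0 (branch S j) := fun j hj => hroot (obs0_root_of_branch hj)
      let a : Fin m := ⟨0, by omega⟩
      let b : Fin m := ⟨1, by omega⟩
      have hc : ∀ j, ¬ Obs0 (branch S j) (some (root m h)) := fun j hj =>
        ho ((ih (hP j) (hn j)).1 hj)
      exact not_pd1_of_two hr (a := a) (b := b) (by simp [a, b]) (hc a) (hc b) h1

/-- Power domination in the complete tree in terms of the extended tree. -/
theorem isPowerDominating_completeTree_iff {S : Set (TreeVertex m h)} :
    IsPowerDominating (completeTree m h) S ↔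
      PD0 S ∨ (PD1 S ∧ Obs0 S (some (root m h))) := by
  rw [isPowerDominating_iff]
  -- The stem only obstructs forces by the root, so it is harmless once observed (`up`), or as long
  -- as the root is unobserved (`up0`). Conversely, `down` and `down1` collapse the stem onto the
  -- root.
  have up : ∀ {B : Set (Option (TreeVertex m h))}, some '' S ⊆ B →
      Obs (extendedTree m h) B none →
      ∀ x, Obs (completeTree m h) S x → Obs (extendedTree m h) B (some x) := by
    intro B hB hn x hx
    induction hx with
    | mem hv => exact .mem (hB ⟨_, hv, rfl⟩)
    | dom hv ha => exact .dom (hB ⟨_, hv, rfl⟩) (extendedTree_adj_some_some.2 ha)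
    | force _ ha _ ihv ih =>
      refine .force ihv (extendedTree_adj_some_some.2 ha) fun y hy hne => ?_
      rcases y with _ | y
      · exact hn
      · exact ih y (extendedTree_adj_some_some.1 hy) (by rintro rfl; exact hne rfl)
  have up0 : ¬ Obs0 S (some (root m h)) → ∀ x, Obs (completeTree m h) S x → Obs0 S (some x) := by
    intro hroot x hx
    induction hx with
    | mem hv => exact .mem ⟨_, hv, rfl⟩
    | dom hv ha => exact .dom ⟨_, hv, rfl⟩ (extendedTree_adj_some_some.2 ha)
    | force _ ha _ ihv ih =>
      refine .force ihv (extendedTree_adj_some_some.2 ha) fun y hy hne => ?_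
      rcases y with _ | y
      · rw [extendedTree_adj_some_none] at hy
        subst hy
        exact absurd ihv hroot
      · exact ih y (extendedTree_adj_some_some.1 hy) (by rintro rfl; exact hne rfl)
  have down : ∀ x, Obs0 S x → Obs (completeTree m h) S (x.getD (root m h)) := by
    intro x hx
    induction hx with
    | mem hv =>
      obtain ⟨v, hv, rfl⟩ := hv
      exact .mem hv
    | @dom v x hv ha =>
      obtain ⟨v, hv, rfl⟩ := hv
      rcases x with _ | x
      · rw [extendedTree_adj_some_none] at ha
        subst ha
        exact .mem hv
      · exact .dom hv (extendedTree_adj_some_some.1 ha)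
    | @force v x _ ha _ ihv ih =>
      rcases v with _ | v
      · rw [extendedTree_adj_none] at ha
        subst ha
        exact ihv
      · rcases x with _ | x
        · rw [extendedTree_adj_some_none] at ha
          subst ha
          exact ihv
        · exact .force ihv (extendedTree_adj_some_some.1 ha) fun y hy hne =>
            ih (some y) (extendedTree_adj_some_some.2 hy) (by simpa [graftStem] using hne)
  have down1 : Obs (completeTree m h) S (root m h) →
      ∀ x, Obs1 S x → Obs (completeTree m h) S (x.getD (root m h)) := by
    intro hroot x hx
    induction hx with
    | mem hv =>
      rcases hv with ⟨v, hv, rfl⟩ | rfl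
      · exact .mem hv
      · exact hroot
    | @dom v x hv ha =>
      rcases x with _ | x
      · exact hroot
      · rcases hv with ⟨v, hv, rfl⟩ | rfl
        · exact .dom hv (extendedTree_adj_some_some.1 ha)
        · rw [extendedTree_adj_none] at ha
          cases ha
          exact hroot
    | @force v x _ ha _ ihv ih =>
      rcases v with _ | v
      · rw [extendedTree_adj_none] at ha
        subst ha
        exact ihv
      · rcases x with _ | x
        · exact hroot
        · exact .force ihv (extendedTree_adj_some_some.1 ha) fun y hy hne =>
            ih (some y) (extendedTree_adj_some_some.2 hy) (by simpa [graftStem] using hne)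
  constructor
  · intro hS
    right
    constructor
    · rintro (_ | x)
      · exact .mem (by simp)
      · exact up Set.subset_union_left (.mem (by simp)) x (hS x)
    · by_contra hroot
      exact hroot (up0 hroot _ (hS _))
  · rintro (hS | ⟨hS, hroot⟩) x
    · exact down (some x) (hS _)
    · exact down1 (down _ hroot) (some x) (hS _)

/-- All branch roots are observed from inside, so only the root is missing, and it takes one Type I
branch to observe it. -/
theorem isPowerDominating_completeTree_succ_iff_of_odd (hm : 2 ≤ m) (ho : Odd h) :
    IsPowerDominating (completeTree m (h + 1)) S ↔
      (∀ j, PD1 (branch S j)) ∧ (root m (h + 1) ∈ S ∨ ∃ j, PD0 (branch S j)) := by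
  rw [isPowerDominating_completeTree_iff]
  have hc : (∀ j, PD1 (branch S j)) → ∀ j, Obs0 (branch S j) (some (root m h)) := fun hP j => by
    by_cases hj : PD0 (branch S j)
    · exact hj _
    · exact (obs0_root_iff_odd hm (hP j) hj).2 ho
  constructor
  · intro hS
    have h1 : PD1 S := hS.elim PD0.pd1 And.left
    have hroot : Obs0 S (some (root m (h + 1))) := hS.elim (fun h' => h' _) And.right
    refine ⟨h1.branch, ?_⟩
    by_contra! hn
    exact not_obs0_root hn.1 (fun j => not_obs0_none (h1.branch j) (hn.2 j)) hroot
  · rintro ⟨hP, hr | ⟨j, hj⟩⟩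
    · exact Or.inl (pd0_of_root_mem hr hP)
    · exact Or.inl (pd0_of_children hP (hc hP) hj)

/-- Two Type II branches have unobserved roots, which the root cannot force. With at most one, the
stem suffices, and `obs0_root_iff_odd` at the odd height `h + 1` disposes of the stem. -/
theorem isPowerDominating_completeTree_succ_iff_of_even (hm : 2 ≤ m) (he : Even h) :
    IsPowerDominating (completeTree m (h + 1)) S ↔
      (∀ j, PD1 (branch S j)) ∧
        (root m (h + 1) ∈ S ∨ ∀ a b, ¬ PD0 (branch S a) → ¬ PD0 (branch S b) → a = b) := by
  rw [isPowerDominating_completeTree_iff]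
  constructor
  · intro hS
    have h1 : PD1 S := hS.elim PD0.pd1 And.left
    refine ⟨h1.branch, ?_⟩
    by_contra! hn
    obtain ⟨hr, a, b, ha, hb, hab⟩ := hn
    have hc : ∀ j, ¬ PD0 (branch S j) → ¬ Obs0 (branch S j) (some (root m h)) := fun j hj ho =>
      Nat.not_odd_iff_even.2 he ((obs0_root_iff_odd hm (h1.branch j) hj).1 ho)
    exact not_pd1_of_two hr hab (hc a ha) (hc b hb) h1
  · rintro ⟨hP, hr | hc⟩
    · exact Or.inl (pd0_of_root_mem hr hP)
    · have h1 := pd1_of_subsingleton hP hc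
      by_cases h0 : PD0 S
      · exact Or.inl h0
      · exact Or.inr ⟨h1, (obs0_root_iff_odd hm h1 h0).2 he.add_one⟩

end Parity

end Tree

open Polynomial

/-! ### The multinomial theorem over non-decreasing sequences -/

section Multinomial

theorem exists_monotone_card_eq {α : Type*} [LinearOrder α] [Fintype α] {n : ℕ} (s : α → ℕ)
    (hs : ∑ a, s a = n) : ∃ f : Fin n → α, Monotone f ∧ ∀ a, #{j | f j = a} = s a := by
  have hcard : Fintype.card (Σ a, Fin (s a)) = n := by simpa using hs
  let e : (Σ a, Fin (s a)) ≃ Fin n := Fintype.equivFinOfCardEq hcard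
  let g : Fin n → α := fun j => (e.symm j).1
  refine ⟨g ∘ Tuple.sort g, Tuple.monotone_sort g, fun a => ?_⟩
  calc #{j | (g ∘ Tuple.sort g) j = a}
      = Fintype.card {p : Σ a, Fin (s a) // p.1 = a} := by
        rw [← Fintype.card_subtype]
        exact Fintype.card_congr
          (((Tuple.sort g).trans e.symm).subtypeEquiv fun j => Iff.rfl)
    _ = Fintype.card (Fin (s a)) := Fintype.card_congr (Equiv.sigmaSubtype a)
    _ = s a := by simp

/-- Equal multiplicities make the lists of values permutations of each other, and sorted
permutations coincide. -/
theorem Monotone.eq_of_card_eq {α : Type*} [LinearOrder α] {n : ℕ} {f g : Fin n → α}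
    (hf : Monotone f) (hg : Monotone g) (hfg : ∀ a, #{j | f j = a} = #{j | g j = a}) : f = g := by
  have hcount : ∀ (u : Fin n → α) (a : α), (List.ofFn u).count a = #{j | u j = a} := by
    intro u a
    rw [← Multiset.coe_count, ← Fin.univ_val_map, Multiset.count_map]
    simp [Finset.card_def, eq_comm]
  refine List.ofFn_injective (List.Perm.eq_of_sortedLE hf.sortedLE_ofFn hg.sortedLE_ofFn ?_)
  rw [List.perm_iff_count]
  intro a
  rw [hcount, hcount, hfg]

/-- The multinomial theorem, with the terms indexed by non-decreasing sequences. -/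
theorem sum_pow_eq_sum_monotone {α R : Type*} [LinearOrder α] [Fintype α] [CommSemiring R]
    (c : α → R) (n : ℕ) :
    (∑ a, c a) ^ n = ∑ f : Fin n → α with Monotone f,
      (Nat.multinomial univ (fun a => #{j | f j = a}) : R) * ∏ j, c (f j) := by
  rw [sum_pow_eq_sum_piAntidiag]
  symm
  refine Finset.sum_bij (fun f _ a => #{j | f j = a}) ?_ ?_ ?_ ?_
  · intro f _
    simp only [mem_piAntidiag, mem_univ, implies_true, and_true]
    rw [← Finset.card_eq_sum_card_fiberwise (fun _ _ => mem_coe.2 (mem_univ _))]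
    simp
  · intro f hf g hg hfg
    exact Monotone.eq_of_card_eq (mem_filter.1 hf).2 (mem_filter.1 hg).2 (congrFun hfg)
  · intro s hs
    obtain ⟨f, hf, hfs⟩ := exists_monotone_card_eq s (mem_piAntidiag.1 hs).1
    exact ⟨f, by simpa using hf, funext hfs⟩
  · intro f _
    congr 1
    rw [← Finset.prod_fiberwise' univ f c]
    simp

end Multinomial

/-! ### Truncating polynomials -/

section Coefficients

variable {R : Type*} [CommSemiring R]

/-- Bracket indices only run up to `k`; this allows generating functions to be cut off at degree
`k`. -/
theorem coeff_mul_congr {p p' q q' : R[X]} {k : ℕ} (hp : ∀ i ≤ k, p.coeff i = p'.coeff i)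
    (hq : ∀ i ≤ k, q.coeff i = q'.coeff i) : ∀ i ≤ k, (p * q).coeff i = (p' * q').coeff i := by
  intro i hi
  rw [coeff_mul, coeff_mul]
  refine Finset.sum_congr rfl fun x hx => ?_
  have := mem_antidiagonal.1 hx
  rw [hp _ (by omega), hq _ (by omega)]

theorem coeff_pow_congr {p p' : R[X]} {k : ℕ} (hp : ∀ i ≤ k, p.coeff i = p'.coeff i) (n : ℕ) :
    ∀ i ≤ k, (p ^ n).coeff i = (p' ^ n).coeff i := by
  induction n with
  | zero => simp
  | succ n ih =>
    simp only [pow_succ]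
    exact coeff_mul_congr ih hp

theorem coeff_sum_monomial {p : R[X]} {k : ℕ} :
    ∀ i ≤ k, p.coeff i = (∑ a : Fin (k + 1), monomial (a : ℕ) (p.coeff a)).coeff i := by
  intro i hi
  rw [Fin.sum_univ_eq_sum_range (fun a => monomial a (p.coeff a)), finsetSum_coeff]
  simp [coeff_monomial, Nat.lt_succ_iff.2 hi]

theorem prod_monomial {ι : Type*} (s : Finset ι) (e : ι → ℕ) (c : ι → R) :
    ∏ j ∈ s, monomial (e j) (c j) = monomial (∑ j ∈ s, e j) (∏ j ∈ s, c j) := by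
  classical
  induction s using Finset.induction_on with
  | empty => simp
  | insert a s ha ih => rw [prod_insert ha, sum_insert ha, prod_insert ha, ih, monomial_mul_monomial]

end Coefficients

/-! ### The bracket sum as a coefficient -/

section Bracket

variable {m h : ℕ}

open Classical in
theorem bracket_natCast (m h l k : ℕ) :
    bracket m h l k = ∑ i : Fin m → Fin (k + 1) with
      (∀ a b : Fin m, a ≤ b → b.1 < l → i a ≤ i b) ∧
      (∀ a b : Fin m, a ≤ b → l ≤ a.1 → i a ≤ i b) ∧
      ∑ j, ((i j : ℕ) : ℤ) = k,
    m.choose l *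
      Nat.multinomial univ (fun α => #{j : Fin m | j.1 < l ∧ i j = α}) *
      Nat.multinomial univ (fun β => #{j : Fin m | l ≤ j.1 ∧ i j = β}) *
      (∏ j : Fin m with j.1 < l, numTypeII m h (i j)) *
      (∏ j : Fin m with l ≤ j.1, numTypeI m h (i j)) := rfl

/-- `Fin.append` splits a sequence into its first `l` and last `r` terms; the monotonicity
conditions separate and only the total sum couples the halves. -/
theorem bracket_eq_sum (l r h k : ℕ) :
    bracket (l + r) h l k =
      ∑ f : Fin l → Fin (k + 1) with Monotone f, ∑ g : Fin r → Fin (k + 1) with Monotone g,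
        if ∑ j, (f j : ℕ) + ∑ j, (g j : ℕ) = k then
          (l + r).choose l * Nat.multinomial univ (fun a => #{j | f j = a}) *
            Nat.multinomial univ (fun a => #{j | g j = a}) *
            (∏ j, numTypeII (l + r) h (f j)) * ∏ j, numTypeI (l + r) h (g j)
        else 0 := by
  classical
  have hcardl : ∀ (f : Fin l → Fin (k + 1)) (g : Fin r → Fin (k + 1)) (a : Fin (k + 1)),
      #{j : Fin (l + r) | j.1 < l ∧ Fin.append f g j = a} = #{j | f j = a} := by
    intro f g a
    simp only [Finset.card_filter, Fin.sum_univ_add]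
    simp
  have hcardr : ∀ (f : Fin l → Fin (k + 1)) (g : Fin r → Fin (k + 1)) (a : Fin (k + 1)),
      #{j : Fin (l + r) | l ≤ j.1 ∧ Fin.append f g j = a} = #{j | g j = a} := by
    intro f g a
    simp only [Finset.card_filter, Fin.sum_univ_add]
    simp [Nat.not_le.2 (Fin.is_lt _)]
  have hmonol : ∀ (f : Fin l → Fin (k + 1)) (g : Fin r → Fin (k + 1)),
      (∀ a b : Fin (l + r), a ≤ b → b.1 < l → Fin.append f g a ≤ Fin.append f g b) ↔
        Monotone f := by
    intro f g
    constructor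
    · intro H a b hab
      simpa using H (Fin.castAdd r a) (Fin.castAdd r b) hab (by simp)
    · intro hf a b hab hb
      obtain ⟨b, rfl⟩ : ∃ b', b = Fin.castAdd r b' := ⟨⟨b, hb⟩, rfl⟩
      obtain ⟨a, rfl⟩ : ∃ a', a = Fin.castAdd r a' := ⟨⟨a, lt_of_le_of_lt hab hb⟩, rfl⟩
      simpa using hf (show a ≤ b from hab)
  have hmonor : ∀ (f : Fin l → Fin (k + 1)) (g : Fin r → Fin (k + 1)),
      (∀ a b : Fin (l + r), a ≤ b → l ≤ a.1 → Fin.append f g a ≤ Fin.append f g b) ↔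
        Monotone g := by
    intro f g
    constructor
    · intro H a b hab
      simpa using H (Fin.natAdd l a) (Fin.natAdd l b) (by simpa using hab) (by simp)
    · intro hg a b hab ha
      have key : ∀ c : Fin (l + r), l ≤ c.1 → ∃ c', c = Fin.natAdd l c' := fun c hc =>
        ⟨⟨c.1 - l, by omega⟩, Fin.ext (by simp; omega)⟩
      obtain ⟨b, rfl⟩ := key b (ha.trans hab)
      obtain ⟨a, rfl⟩ := key a ha
      simpa using hg (by simpa using hab)
  rw [bracket_natCast, Finset.sum_filter, ← (Fin.appendEquiv l r).sum_comp, Fintype.sum_prod_type,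
    Finset.sum_filter]
  refine Finset.sum_congr rfl fun f _ => ?_
  rw [Finset.sum_filter]
  by_cases hf : Monotone f
  · rw [if_pos hf]
    refine Finset.sum_congr rfl fun g _ => ?_
    by_cases hg : Monotone g
    · have hsum : ∑ j, (((Fin.append f g j : Fin (k + 1)) : ℕ) : ℤ) = k ↔
          ∑ j, (f j : ℕ) + ∑ j, (g j : ℕ) = k := by
        rw [Fin.sum_univ_add]
        simp only [Fin.append_left, Fin.append_right]
        exact_mod_cast Iff.rfl
      have hpl : ∏ j : Fin (l + r) with j.1 < l, numTypeII (l + r) h (Fin.append f g j : Fin (k + 1)) =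
          ∏ j, numTypeII (l + r) h (f j) := by
        simp [Finset.prod_filter, Fin.prod_univ_add]
      have hpr : ∏ j : Fin (l + r) with l ≤ j.1, numTypeI (l + r) h (Fin.append f g j : Fin (k + 1)) =
          ∏ j, numTypeI (l + r) h (g j) := by
        simp [Finset.prod_filter, Fin.prod_univ_add, Nat.not_le.2 (Fin.is_lt _)]
      simp only [Fin.appendEquiv, Equiv.coe_fn_mk, hmonol, hmonor, hsum, hf, hg, true_and,
        if_true, hpl, hpr, ← hcardl f g, ← hcardr f g]
      congr!
    · simp only [Fin.appendEquiv, Equiv.coe_fn_mk, hmonor, hg, false_and, and_false, if_false]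
  · simp only [Fin.appendEquiv, Equiv.coe_fn_mk, hmonol, hf, false_and, if_false, sum_const_zero]

/-- The bracket sum is a coefficient of the product of the generating functions. -/
theorem bracket_eq_coeff {l : ℕ} (hl : l ≤ m) {p q : ℕ[X]} (hp : ∀ i, p.coeff i = numTypeII m h i)
    (hq : ∀ i, q.coeff i = numTypeI m h i) (k : ℕ) :
    bracket m h l k = (m.choose l * (p ^ l * q ^ (m - l))).coeff k := by
  obtain ⟨r, rfl⟩ := Nat.exists_eq_add_of_le hl
  -- After truncation each factor is a power of a sum over `Fin (k + 1)`, as the multinomial theorem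
  -- requires.
  rw [Nat.add_sub_cancel_left, bracket_eq_sum, ← C_eq_natCast, coeff_C_mul,
    coeff_mul_congr (coeff_pow_congr (coeff_sum_monomial (k := k)) l)
      (coeff_pow_congr (coeff_sum_monomial (k := k)) r) k le_rfl,
    sum_pow_eq_sum_monotone, sum_pow_eq_sum_monotone, Finset.sum_mul_sum, finsetSum_coeff,
    Finset.mul_sum]
  refine Finset.sum_congr rfl fun f _ => ?_
  rw [finsetSum_coeff, Finset.mul_sum]
  refine Finset.sum_congr rfl fun g _ => ?_
  rw [prod_monomial, prod_monomial, mul_mul_mul_comm, monomial_mul_monomial, ← Nat.cast_mul,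
    ← C_eq_natCast, coeff_C_mul, coeff_monomial]
  simp only [hp, hq]
  split_ifs
  · simp only [Nat.cast_id]
    ring
  · simp

/-- Since `(-1).toNat = 0`, the zero sequence is still a candidate; the condition on the sum
excludes it. -/
theorem bracket_neg_one (m h l : ℕ) : bracket m h l (-1) = 0 := by
  classical
  unfold bracket
  refine Finset.sum_eq_zero fun i hi => ?_
  have h0 : 0 ≤ ∑ j, ((i j : ℕ) : ℤ) := by positivity
  have := (mem_filter.1 hi).2.2.2
  omega

end Bracket

/-! ### Generating functions of families of sets -/

section GeneratingFunction

open Classical in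
/-- The generating function by size of the sets with a given property. -/
noncomputable def genPoly {V : Type*} [Fintype V] (P : Set V → Prop) : ℕ[X] :=
  ∑ S ∈ univ.filter fun S : Finset V => P S, X ^ #S

theorem coeff_genPoly {V : Type*} [Fintype V] (P : Set V → Prop) (k : ℕ) :
    (genPoly P).coeff k = {S : Finset V | #S = k ∧ P S}.ncard := by
  classical
  have : {S : Finset V | #S = k ∧ P S} =
      (((univ.filter fun S : Finset V => P S).filter fun S => k = #S : Finset (Finset V)) :
        Set (Finset V)) := by
    ext S
    simp [and_comm, eq_comm]
  rw [this, Set.ncard_coe_finset, genPoly, finsetSum_coeff, Finset.card_filter]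
  simp only [coeff_X_pow]

open Classical in
/-- Families of sets having one of two exclusive properties, counted by total size and by the
number of members having the second property. -/
theorem sum_families {V ι : Type*} [Fintype V] [Fintype ι] (P Q : Set V → Prop)
    (hPQ : ∀ S, P S → ¬ Q S) (c : ℕ → Prop) :
    (∑ F : ι → Finset V with (∀ j, P (F j) ∨ Q (F j)) ∧ c #{j | Q (F j)},
        (X : ℕ[X]) ^ ∑ j, #(F j)) =
      ∑ l ∈ range (Fintype.card ι + 1) with c l,
        ((Fintype.card ι).choose l * (genPoly Q ^ l * genPoly P ^ (Fintype.card ι - l)) : ℕ[X]) := by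
  -- Once the set `A` of members with property `Q` is fixed, the members vary independently and the
  -- sum factors.
  have hprod : ∀ A : Finset ι, (∑ F : ι → Finset V with
      (∀ j, P (F j) ∨ Q (F j)) ∧ ({j | Q (F j)} : Finset ι) = A, (X : ℕ[X]) ^ ∑ j, #(F j)) =
        genPoly Q ^ #A * genPoly P ^ (Fintype.card ι - #A) := by
    intro A
    have : (genPoly Q ^ #A * genPoly P ^ (Fintype.card ι - #A) : ℕ[X]) =
        ∏ j, ∑ S ∈ univ.filter fun S : Finset V => if j ∈ A then Q S else P S, X ^ #S := by
      rw [← Finset.prod_mul_prod_compl A, ← card_compl]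
      congr 1
      · rw [Finset.prod_congr rfl (g := fun _ => genPoly Q), prod_const]
        intro j hj
        simp [hj, genPoly]
      · rw [Finset.prod_congr rfl (g := fun _ => genPoly P), prod_const]
        intro j hj
        simp [mem_compl.1 hj, genPoly]
    rw [this, Finset.prod_univ_sum]
    simp only [Finset.prod_pow_eq_pow_sum]
    refine Finset.sum_congr ?_ fun _ _ => rfl
    ext F
    simp only [mem_filter, mem_univ, true_and, Fintype.mem_piFinset, Finset.ext_iff]
    constructor
    · rintro ⟨h1, h2⟩ j
      by_cases hj : j ∈ A
      · simpa [hj] using (h2 j).2 hj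
      · have := mt (h2 j).1 hj
        simpa [hj, this] using h1 j
    · intro H
      refine ⟨fun j => ?_, fun j => ?_⟩
      · have := H j
        split_ifs at this
        exacts [Or.inr this, Or.inl this]
      · have := H j
        split_ifs at this with hj
        · simp [this, hj]
        · simp [hPQ _ this, hj]
  rw [← Finset.sum_fiberwise_of_maps_to (t := univ.filter fun A : Finset ι => c #A)
    (g := fun F : ι → Finset V => ({j | Q (F j)} : Finset ι)) (by simp)]
  have hinner : ∀ A ∈ (univ.filter fun A : Finset ι => c #A),
      (∑ F ∈ ({F | (∀ j, P (F j) ∨ Q (F j)) ∧ c #{j | Q (F j)}} : Finset (ι → Finset V)) with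
        ({j | Q (F j)} : Finset ι) = A, (X : ℕ[X]) ^ ∑ j, #(F j)) =
      genPoly Q ^ #A * genPoly P ^ (Fintype.card ι - #A) := by
    intro A hA
    rw [← hprod A]
    refine Finset.sum_congr ?_ fun _ _ => rfl
    ext F
    simp only [mem_filter, mem_univ, true_and] at hA ⊢
    constructor
    · rintro ⟨⟨h1, -⟩, h2⟩
      exact ⟨h1, h2⟩
    · rintro ⟨h1, h2⟩
      exact ⟨⟨h1, by rwa [h2]⟩, h2⟩
  -- The contribution depends on `A` only through its size, which produces the binomial coefficient.
  rw [Finset.sum_congr rfl hinner, Finset.sum_filter, Finset.sum_filter,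
    ← Finset.powerset_univ, Finset.sum_powerset]
  refine Finset.sum_congr (by simp) fun l _ => ?_
  rw [Finset.sum_congr rfl (g := fun _ => if c l then
    genPoly Q ^ l * genPoly P ^ (Fintype.card ι - l) else 0)]
  · split_ifs <;> simp
  · intro A hA
    rw [(mem_powersetCard.1 hA).2]

end GeneratingFunction

/-! ### Assembling sets from their branches and counting -/

section Assembly

variable {m h : ℕ}

open Classical in
/-- The set of vertices consisting of the given parts of the branches, and of the root if `b`. -/
noncomputable def assemble (b : Bool) (F : Fin m → Finset (TreeVertex m h)) :
    Finset (TreeVertex m (h + 1)) :=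
  (if b then {root m (h + 1)} else ∅) ∪ univ.biUnion fun j => (F j).image (graft j)

@[simp] theorem root_mem_assemble {b : Bool} {F : Fin m → Finset (TreeVertex m h)} :
    root m (h + 1) ∈ assemble b F ↔ b := by
  cases b <;> simp [assemble]

@[simp] theorem graft_mem_assemble {b : Bool} {F : Fin m → Finset (TreeVertex m h)} {j : Fin m}
    {w : TreeVertex m h} : graft j w ∈ assemble b F ↔ w ∈ F j := by
  cases b <;> simp [assemble]

@[simp] theorem branch_assemble {b : Bool} {F : Fin m → Finset (TreeVertex m h)} {j : Fin m} :
    branch (assemble b F : Set (TreeVertex m (h + 1))) j = F j := by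
  ext w
  simp [branch]

theorem card_assemble (b : Bool) (F : Fin m → Finset (TreeVertex m h)) :
    #(assemble b F) = b.toNat + ∑ j, #(F j) := by
  classical
  rw [assemble, card_union_of_disjoint, card_biUnion]
  · congr 1
    · cases b <;> simp
    · exact Finset.sum_congr rfl fun j _ =>
        card_image_of_injective _ fun v w hvw => (graft_inj.1 hvw).2
  · intro i _ j _ hij
    rw [Function.onFun, Finset.disjoint_left]
    simp only [mem_image]
    rintro _ ⟨v, -, rfl⟩ ⟨w, -, hw⟩
    exact hij (graft_inj.1 hw).1.symm
  · cases b <;> simp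

theorem assemble_bijective : Function.Bijective
    fun p : Bool × (Fin m → Finset (TreeVertex m h)) => assemble p.1 p.2 := by
  classical
  constructor
  · rintro ⟨b, F⟩ ⟨b', F'⟩ hF
    simp only [Finset.ext_iff] at hF
    refine Prod.ext ?_ (funext fun j => Finset.ext fun w => ?_)
    · exact Bool.eq_iff_iff.2 (by simpa using hF (root m (h + 1)))
    · simpa using hF (graft j w)
  · intro S
    refine ⟨(decide (root m (h + 1) ∈ S), fun j => {w | graft j w ∈ S}), Finset.ext fun v => ?_⟩
    rcases eq_root_or_graft v with rfl | ⟨j, w, rfl⟩ <;> simp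

open Classical in
/-- The sets of the tree of height `h + 1` that consist of parts of the extended branches that are
dominating up to the help of the root, and which contain the root or satisfy a condition on the
number of branches that need this help. -/
theorem genPoly_of_branches {P : Set (TreeVertex m (h + 1)) → Prop} {c : ℕ → Prop}
    (hP : ∀ S, P S ↔ (∀ j, PD1 (branch S j)) ∧
      (root m (h + 1) ∈ S ∨ c #{j : Fin m | ¬ PD0 (branch S j)})) :
    genPoly P =
      (∑ l ∈ range (m + 1) with c l, (m.choose l * (genPoly (fun S : Set (TreeVertex m h) =>
        ¬ PD0 S ∧ PD1 S) ^ l * genPoly (PD0 (m := m) (h := h)) ^ (m - l)) : ℕ[X])) +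
      X * ∑ l ∈ range (m + 1), (m.choose l * (genPoly (fun S : Set (TreeVertex m h) =>
        ¬ PD0 S ∧ PD1 S) ^ l * genPoly (PD0 (m := m) (h := h)) ^ (m - l)) : ℕ[X]) := by
  have hfam := fun c => sum_families (ι := Fin m) (V := TreeVertex m h) PD0
    (fun S => ¬ PD0 S ∧ PD1 S) (fun S hS hS' => hS'.1 hS) c
  simp only [Fintype.card_fin] at hfam
  have htrue := hfam fun _ => True
  simp only [filter_true] at htrue
  have hiff : ∀ S : Set (TreeVertex m h), PD1 S ↔ PD0 S ∨ (¬ PD0 S ∧ PD1 S) := fun S => by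
    by_cases h0 : PD0 S
    · simp [h0, h0.pd1]
    · simp [h0]
  rw [← hfam c, ← htrue, genPoly, Finset.sum_filter,
    ← assemble_bijective.sum_comp (fun S : Finset (TreeVertex m (h + 1)) =>
      if P S then (X : ℕ[X]) ^ #S else 0),
    Fintype.sum_prod_type, Fintype.sum_bool, add_comm, Finset.mul_sum, Finset.sum_filter,
    Finset.sum_filter]
  congr 1
  · refine Finset.sum_congr (by ext; simp) fun F _ => ?_
    simp only [hP, branch_assemble, mem_coe, root_mem_assemble, card_assemble, Bool.toNat_false,
      zero_add, Bool.false_eq_true, false_or, ← hiff]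
    by_cases hF : ∀ j, PD1 (F j : Set (TreeVertex m h))
    · simp [hF]
    · simp [hF]
  · refine Finset.sum_congr (by ext; simp) fun F _ => ?_
    simp only [hP, branch_assemble, mem_coe, root_mem_assemble, card_assemble, Bool.toNat_true,
      true_or, and_true, pow_add, pow_one, ← hiff]

theorem ncard_map_some (k : ℕ) (P : Set (Option (TreeVertex m h)) → Prop) :
    {S : Finset (Option (TreeVertex m h)) | #S = k ∧ none ∉ S ∧ P S}.ncard =
      {S : Finset (TreeVertex m h) | #S = k ∧ P (some '' (S : Set (TreeVertex m h)))}.ncard := by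
  refine (congrArg Set.ncard (Set.ext fun S => ?_)).trans
    (Set.ncard_image_of_injective _ (Finset.map_injective Function.Embedding.some))
  simp only [Set.mem_ofPred_eq, Set.mem_image]
  constructor
  · rintro ⟨hk, hn, hP⟩
    have hS : (eraseNone S).map Function.Embedding.some = S := by
      rw [map_some_eraseNone, erase_eq_of_notMem hn]
    refine ⟨eraseNone S, ⟨?_, ?_⟩, hS⟩
    · rw [← card_map Function.Embedding.some, hS, hk]
    · rw [← hS, coe_map] at hP
      exact hP
  · rintro ⟨T, ⟨hk, hP⟩, rfl⟩
    refine ⟨by simpa using hk, by simp, ?_⟩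
    rw [coe_map]
    exact hP

theorem coeff_genPoly_pd0 (k : ℕ) : (genPoly (PD0 (m := m) (h := h))).coeff k = numTypeI m h k := by
  rw [coeff_genPoly, numTypeI]
  simp only [IsTypeI]
  rw [ncard_map_some k fun S => IsPowerDominating (extendedTree m h) S]
  simp only [isPowerDominating_iff, PD0]

theorem coeff_genPoly_pd1 (k : ℕ) :
    (genPoly (fun S : Set (TreeVertex m h) => ¬ PD0 S ∧ PD1 S)).coeff k = numTypeII m h k := by
  rw [coeff_genPoly, numTypeII]
  simp only [IsTypeII]
  rw [ncard_map_some k fun S => ¬ IsPowerDominating (extendedTree m h) S ∧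
    IsPowerDominating (extendedTree m h) (S ∪ {none})]
  simp only [isPowerDominating_iff, PD0, PD1]

open Classical in
-- The first sum counts sets avoiding the root, the second those containing it; `l` is the number of
-- Type II branches.
theorem numPowerDominating_succ {c : ℕ → Prop} (k : ℕ)
    (hc : ∀ S : Set (TreeVertex m (h + 1)), IsPowerDominating (completeTree m (h + 1)) S ↔
      (∀ j, PD1 (branch S j)) ∧
        (root m (h + 1) ∈ S ∨ c #{j : Fin m | ¬ PD0 (branch S j)})) :
    numPowerDominating m (h + 1) k =
      (∑ l ∈ range (m + 1) with c l, bracket m h l k) +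
        ∑ l ∈ range (m + 1), bracket m h l ((k : ℤ) - 1) := by
  have hb : ∀ l ∈ range (m + 1), ∀ k : ℕ, _ := fun l hl k => bracket_eq_coeff
    (Nat.lt_succ_iff.1 (mem_range.1 hl)) (coeff_genPoly_pd1 (m := m) (h := h))
    (coeff_genPoly_pd0 (m := m) (h := h)) k
  rw [numPowerDominating, ← coeff_genPoly fun S => IsPowerDominating (completeTree m (h + 1)) S,
    genPoly_of_branches hc, coeff_add, finsetSum_coeff]
  congr 1
  · exact Finset.sum_congr rfl fun l hl => (hb l (mem_filter.1 hl).1 k).symm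
  -- For `k = 0` both sides vanish: the factor `X` has no constant term, and the bracket is taken at
  -- -1.
  · rcases k with _ | k
    · simp [bracket_neg_one]
    · rw [coeff_X_mul, finsetSum_coeff]
      refine Finset.sum_congr rfl fun l hl => ?_
      rw [← hb l hl k]
      simp

end Assembly

end PowerDomination

theorem mainTheorem1 (m h k : ℕ) (hm : 2 ≤ m) (hh : 2 ≤ h) :
    (Even h →
      PowerDomination.numPowerDominating m h k =
        (∑ l ∈ Finset.range m, PowerDomination.bracket m (h - 1) l (k : ℤ)) +
          ∑ l ∈ Finset.range (m + 1), PowerDomination.bracket m (h - 1) l ((k : ℤ) - 1)) ∧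
    (Odd h →
      PowerDomination.numPowerDominating m h k =
        (∑ l ∈ Finset.range 2, PowerDomination.bracket m (h - 1) l (k : ℤ)) +
          ∑ l ∈ Finset.range (m + 1), PowerDomination.bracket m (h - 1) l ((k : ℤ) - 1)) := by
  classical
  obtain ⟨h, rfl⟩ : ∃ n, h = n + 1 := ⟨h - 1, by omega⟩
  simp only [Nat.add_sub_cancel]
  constructor
  · intro he
    -- The branches are one lower than the tree, so the parity flips.
    have ho : Odd h := by
      rw [Nat.even_add_one, Nat.not_even_iff_odd] at he
      exact he
    rw [PowerDomination.numPowerDominating_succ (c := fun l => l < m) k fun S => ?_]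
    · congr 2
      ext l
      simp
      omega
    · rw [PowerDomination.isPowerDominating_completeTree_succ_iff_of_odd hm ho]
      have hlt := Finset.card_lt_iff_ne_univ
        ({j | ¬ PowerDomination.PD0 (PowerDomination.branch S j)} : Finset (Fin m))
      rw [Fintype.card_fin] at hlt
      simp [hlt, Finset.eq_univ_iff_forall]
  · intro ho
    have he : Even h := by
      rw [Nat.odd_add_one, Nat.not_odd_iff_even] at ho
      exact ho
    rw [PowerDomination.numPowerDominating_succ (c := fun l => l ≤ 1) k fun S => ?_]
    · congr 2
      ext l
      simp
      omega
    · rw [PowerDomination.isPowerDominating_completeTree_succ_iff_of_even hm he,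
        Finset.card_le_one]
      simp
      tauto
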